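/- Let $\mathbb{E}$ be a finite-dimensional real Euclidean vector space and $C\subset\mathbb{E}$ a convex subset (not necessarily closed or bounded). A face of a convex set $D$ is a convex subset $F\subset D$ such that for all $x,y\in D$, if the open segment $]x,y[$ meets $F$, then $[x,y]\subset F$; the sets $\emptyset$ and $D$ are faces of $D$. For $x\in C$ put $\mathrm{N}(C,x)=\{u\in\mathbb{E}:\langle u,y-x\rangle\le 0\text{ for all }y\in C\}$. For a non-empty convex subset $F\subset C$ put $\mathrm{N}(C,F)=\mathrm{N}(C,x)$ for any $x$ in the relative interior of $F$, and put $\mathrm{N}(C,\emptyset)=\mathbb{E}$. The normal cone lattice $\mathcal{N}(C)=\{\mathrm{N}(C,F): F\text{ a face of }C\}$ is ordered by inclusion. Let $\operatorname{lin}(C)$ be the translation vector space of the affine hull of $C$ (and $\{0\}$ if $C=\emptyset$). The cone $\operatorname{lin}(C)^\perp$ is the smallest element of $\mathcal{N}(C)$; the normal cones other than $\operatorname{lin}(C)^\perp$ and $\mathbb{E}$ are called proper. An atom of $\mathcal{N}(C)$ is an element $A\ne\operatorname{lin}(C)^\perp$ such that the only element of $\mathcal{N}(C)$ strictly included in $A$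 is $\operatorname{lin}(C)^\perp$. For $v\neq 0$ let $F_\perp(C,v)$ be the set of points of $C$ at which $\langle v,\cdot\rangle$ attains its maximum over $C$. The touching cones of $C$ are $\operatorname{lin}(C)^\perp$, $\mathbb{E}$ and, for every non-zero $v$ with $F_\perp(C,v)\neq\emptyset$, the face of $\mathrm{N}(C,F_\perp(C,v))$ that contains $v$ in its relative interior. The dimension of a non-empty convex set is the dimension of its affine hull. **Theorem.** Let $N$ be a proper normal cone of $C$ such that every touching cone of $C$ included in $N$ is a normal cone of $C$. Then $N$ is a supremum, in the lattice $\mathcal{N}(C)$, of atoms of $\mathcal{N}(C)$. A number of $\dim(N)-\dim(\operatorname{lin}(C)^\perp)$ atoms suffice: $N$ is the supremum of a set of at most that many atoms. -/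

import Mathlib

section ConvexCones

variable {E : Type*} [NormedAddCommGroup E] [InnerProductSpace ℝ E]

/-- `F` is a face of `C`: a convex subset of `C` such that a segment with end points in `C` lies
in `F` as soon as its open segment meets `F`. The empty set and `C` itself are allowed. -/
def IsConvexFace (C F : Set E) : Prop :=
  F ⊆ C ∧ Convex ℝ F ∧
    ∀ x ∈ C, ∀ y ∈ C, (openSegment ℝ x y ∩ F).Nonempty → segment ℝ x y ⊆ F

/-- The set of maximizers of `⟪u, ·⟫` on `C`; for `u ≠ 0` this is the exposed face `F_⊥(C, u)`. -/
def exposedFaceBy (C : Set E) (u : E) : Set E :=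
  {x ∈ C | ∀ y ∈ C, inner ℝ u y ≤ inner ℝ u x}

/-- The normal cone `N(C, x)` of `C` at a point `x` of `C`. -/
def normalConeAt (C : Set E) (x : E) : Set E :=
  {u | ∀ y ∈ C, inner ℝ u (y - x) ≤ 0}

/-- The normal cone `N(C, F)` of a convex subset `F` of `C`: it equals `N(C, x)` for every
relative interior point `x` of `F` (see `normalConeOf_eq_normalConeAt`), and it is the whole
space for `F = ∅` (see `normalConeOf_empty`). -/
def normalConeOf (C F : Set E) : Set E :=
  ⋂ x ∈ intrinsicInterior ℝ F, normalConeAt C x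

theorem normalConeOf_empty (C : Set E) : normalConeOf C ∅ = Set.univ := by
  simp [normalConeOf]

/-- Prolongation of segments beyond relative interior points. -/
theorem exists_prolong_of_mem_intrinsicInterior {F : Set E} {x y : E}
    (hx : x ∈ intrinsicInterior ℝ F) (hy : y ∈ F) :
    ∃ t : ℝ, 0 < t ∧ x + t • (x - y) ∈ F := by
  obtain ⟨p, hp, rfl⟩ := mem_intrinsicInterior.1 hx
  have hmem : ∀ t : ℝ, AffineMap.lineMap y (p : E) (1 + t) ∈ affineSpan ℝ F := fun t =>
    AffineMap.lineMap_mem _ (subset_affineSpan ℝ F hy) p.2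
  let g : ℝ → affineSpan ℝ F := fun t => ⟨AffineMap.lineMap y (p : E) (1 + t), hmem t⟩
  have hg : Continuous g := by
    refine Continuous.subtype_mk ?_ _
    simp only [AffineMap.lineMap_apply_module]
    fun_prop
  have hg0 : g 0 = p := by
    apply Subtype.ext
    simp [g]
  have hopen : ∀ᶠ t in nhds (0 : ℝ), g t ∈ interior ((↑) ⁻¹' F : Set (affineSpan ℝ F)) := by
    apply hg.continuousAt.eventually_mem
    rw [hg0]
    exact isOpen_interior.mem_nhds hp
  obtain ⟨ε, hε, h⟩ := Metric.eventually_nhds_iff.1 hopen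
  refine ⟨ε / 2, by positivity, ?_⟩
  have h2 : dist (ε / 2) (0 : ℝ) < ε := by
    rw [Real.dist_eq, sub_zero, abs_of_pos (by positivity)]
    linarith
  have h5 : g (ε / 2) ∈ ((↑) ⁻¹' F : Set (affineSpan ℝ F)) := interior_subset (h h2)
  have h3 : (g (ε / 2) : E) ∈ F := h5
  have h4 : (g (ε / 2) : E) = p + (ε / 2) • ((p : E) - y) := by
    simp only [g, AffineMap.lineMap_apply_module]
    module
  rwa [h4] at h3

/-- The normal cone of `F` may be computed at any relative interior point of `F`. -/
theorem normalConeOf_eq_normalConeAt {C F : Set E} (hF : F ⊆ C) {x : E}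
    (hx : x ∈ intrinsicInterior ℝ F) : normalConeOf C F = normalConeAt C x := by
  apply Set.Subset.antisymm
  · intro u hu
    exact Set.mem_iInter₂.1 hu x hx
  · intro u hu
    refine Set.mem_iInter₂.2 fun z hz y hy => ?_
    have hzF : z ∈ F := intrinsicInterior_subset hz
    obtain ⟨t, ht, hmem⟩ := exists_prolong_of_mem_intrinsicInterior hx hzF
    have h1 : inner ℝ u (x + t • (x - z) - x) ≤ 0 := hu _ (hF hmem)
    rw [add_sub_cancel_left, inner_smul_right] at h1
    have h2 : inner ℝ u (x - z) ≤ 0 := by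
      by_contra h
      push Not at h
      exact absurd h1 (not_le.2 (mul_pos ht h))
    have h3 : inner ℝ u (y - x) ≤ 0 := hu y hy
    have h4 : y - z = (y - x) + (x - z) := by abel
    rw [h4, inner_add_right]
    linarith

/-- The orthogonal complement `lin(C)^⊥` of the translation space of the affine hull of `C`. -/
noncomputable def linOrthogonal (C : Set E) : Submodule ℝ E := (vectorSpan ℝ C)ᗮ

/-- The normal cone lattice `𝒩(C)`: all normal cones of faces of `C`. As a subtype of `Set E` it
is ordered by inclusion. -/
def normalConeLattice (C : Set E) : Set (Set E) :=
  {N | ∃ F, IsConvexFace C F ∧ N = normalConeOf C F}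

/-- `N` is a proper normal cone of `C`: a normal cone other than `lin(C)^⊥` and the whole space. -/
def IsProperNormalCone (C N : Set E) : Prop :=
  N ∈ normalConeLattice C ∧ N ≠ (linOrthogonal C : Set E) ∧ N ≠ Set.univ

/-- Touching cones of `C`: for every `v ≠ 0` with `F_⊥(C, v)` non-empty, the face of the normal
cone `N(C, F_⊥(C, v))` that has `v` in its relative interior; moreover `lin(C)^⊥` and the whole
space. -/
def touchingConeLattice (C : Set E) : Set (Set E) :=
  {T | (∃ v : E, v ≠ 0 ∧ (exposedFaceBy C v).Nonempty ∧
          IsConvexFace (normalConeOf C (exposedFaceBy C v)) T ∧ v ∈ intrinsicInterior ℝ T) ∨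
        T = (linOrthogonal C : Set E) ∨ T = Set.univ}

/-- The dimension of a non-empty convex set: that of the translation space of its affine hull. -/
noncomputable def convexDim (S : Set E) : ℕ := Module.finrank ℝ (vectorSpan ℝ S)

end ConvexCones

/-- An atom of a partially ordered set with a smallest element `z`: an element `a ≠ z` such that
every element below `a` and different from `a` equals `z`. -/
def IsPosetAtom {X : Type*} [PartialOrder X] (a : X) : Prop :=
  ∃ z : X, IsBot z ∧ a ≠ z ∧ ∀ y : X, y ≤ a → y ≠ a → y = z

/-! A proper normal cone is `N(C, x)` for some `x ∈ C`: a closed convex cone with lineality space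
`lin(C)^⊥`. Each face generated by a nonzero point of it is a touching cone, hence by hypothesis a
normal cone; a minimal face above the lineality space is an atom (`exists_coneFace_isPosetAtom`).
Take `v` in the relative interior of `N` and subtract the largest multiple of a generator of such an
atom that keeps it in `N`. The remainder generates a face of smaller dimension, so iteration writes
`v` as a sum of points of at most `dim N - dim lin(C)^⊥` atoms and a point of `lin(C)^⊥`. Normal
cones are closed under addition, so one containing these atoms contains `v`, and then all of `N` by
`coneFace_normalPointedCone_subset`. -/

/-! ### Faces of a convex cone generated by a point. -/

section ConeFaces

variable {E : Type*} [NormedAddCommGroup E] [InnerProductSpace ℝ E]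

/-- The face of a pointed cone `K` generated by `v`: all `u ∈ K` dominated by a multiple of `v`. -/
def coneFace (K : PointedCone ℝ E) (v : E) : Set E :=
  {u | u ∈ K ∧ ∃ t : ℝ, 0 ≤ t ∧ t • v - u ∈ K}

theorem self_mem_coneFace {K : PointedCone ℝ E} {v : E} (hv : v ∈ K) : v ∈ coneFace K v :=
  ⟨hv, 1, zero_le_one, by simp⟩

theorem coneFace_trans {K : PointedCone ℝ E} {u v w : E} (h : u ∈ coneFace K v)
    (h' : v ∈ coneFace K w) : u ∈ coneFace K w := by
  obtain ⟨hu, t, ht, h1⟩ := h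
  obtain ⟨-, s, hs, h2⟩ := h'
  refine ⟨hu, t * s, mul_nonneg ht hs, ?_⟩
  have h3 := K.add_mem (PointedCone.smul_mem K ht h2) h1
  convert h3 using 1
  module

theorem coneFace_subset {K : PointedCone ℝ E} {v w : E} (h : w ∈ coneFace K v) :
    coneFace K w ⊆ coneFace K v := fun _ hu => coneFace_trans hu h

theorem add_mem_coneFace {K : PointedCone ℝ E} {u u' v : E} (h : u ∈ coneFace K v)
    (h' : u' ∈ coneFace K v) : u + u' ∈ coneFace K v := by
  obtain ⟨hu, t, ht, h1⟩ := h
  obtain ⟨hu', s, hs, h2⟩ := h'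
  refine ⟨K.add_mem hu hu', t + s, add_nonneg ht hs, ?_⟩
  have h3 := K.add_mem h1 h2
  convert h3 using 1
  module

theorem smul_mem_coneFace {K : PointedCone ℝ E} {u v : E} {c : ℝ} (hc : 0 ≤ c)
    (h : u ∈ coneFace K v) : c • u ∈ coneFace K v := by
  obtain ⟨hu, t, ht, h1⟩ := h
  refine ⟨PointedCone.smul_mem K hc hu, c * t, mul_nonneg hc ht, ?_⟩
  have h3 := PointedCone.smul_mem K hc h1
  convert h3 using 1
  module

theorem convex_coneFace (K : PointedCone ℝ E) (v : E) : Convex ℝ (coneFace K v) :=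
  fun _ hx _ hy _ _ ha hb _ => add_mem_coneFace (smul_mem_coneFace ha hx) (smul_mem_coneFace hb hy)

theorem mem_coneFace_of_add_mem {K : PointedCone ℝ E} {a b v : E} (ha : a ∈ K) (hb : b ∈ K)
    (h : a + b ∈ coneFace K v) : a ∈ coneFace K v := by
  obtain ⟨-, t, ht, h1⟩ := h
  refine ⟨ha, t, ht, ?_⟩
  convert K.add_mem h1 hb using 1
  module

theorem isConvexFace_coneFace (K : PointedCone ℝ E) (v : E) :
    IsConvexFace (K : Set E) (coneFace K v) := by
  have key : ∀ x ∈ K, ∀ y ∈ K, ∀ a b : ℝ, 0 < a → 0 < b → a • x + b • y ∈ coneFace K v →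
      x ∈ coneFace K v := by
    intro x hx y hy a b ha hb h
    have h1 := smul_mem_coneFace (inv_pos.2 ha).le (mem_coneFace_of_add_mem
      (PointedCone.smul_mem K ha.le hx) (PointedCone.smul_mem K hb.le hy) h)
    rwa [inv_smul_smul₀ ha.ne'] at h1
  refine ⟨fun u hu => hu.1, convex_coneFace K v, ?_⟩
  rintro x hx y hy ⟨_, ⟨a, b, ha, hb, -, rfl⟩, h⟩
  refine (convex_coneFace K v).segment_subset (key x hx y hy a b ha hb h) ?_
  rw [add_comm] at h
  exact key y hy x hx b a hb ha h

/-- The homothety `g` with centre `q` and ratio `b⁻¹` sends `v` to `p`. Pulling the relative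
interior back along `g` gives an open neighbourhood of `v`, inside `S` by convexity. -/
theorem mem_intrinsicInterior_of_mem_openSegment {S : Set E} (hS : Convex ℝ S) {p q v : E}
    (hp : p ∈ intrinsicInterior ℝ S) (hq : q ∈ S) (hv : v ∈ openSegment ℝ q p) :
    v ∈ intrinsicInterior ℝ S := by
  obtain ⟨p, hp, rfl⟩ := mem_intrinsicInterior.1 hp
  obtain ⟨a, b, ha, hb, hab, rfl⟩ := hv
  have hmem : ∀ (y : E) (c : ℝ), y ∈ affineSpan ℝ S →
      AffineMap.lineMap q y c ∈ affineSpan ℝ S := fun y c hy =>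
    AffineMap.lineMap_mem _ (subset_affineSpan ℝ S hq) hy
  have hv : a • q + b • (p : E) = AffineMap.lineMap q (p : E) b := by
    rw [AffineMap.lineMap_apply_module, ← hab, add_sub_cancel_right]
  let g : affineSpan ℝ S → affineSpan ℝ S :=
    fun y => ⟨AffineMap.lineMap q (y : E) b⁻¹, hmem y _ y.2⟩
  have hg : Continuous g := by
    refine Continuous.subtype_mk ?_ _
    simp only [AffineMap.lineMap_apply_module]
    fun_prop
  refine mem_intrinsicInterior.2 ⟨⟨_, hmem p b p.2⟩, ?_, hv.symm⟩
  refine mem_interior.2 ⟨g ⁻¹' interior ((↑) ⁻¹' S), ?_, isOpen_interior.preimage hg, ?_⟩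
  · intro y hy
    have h0 : g y ∈ ((↑) ⁻¹' S : Set (affineSpan ℝ S)) := interior_subset hy
    have h1 : AffineMap.lineMap q (y : E) b⁻¹ ∈ S := h0
    have h2 := hS hq h1 ha.le hb.le hab
    have h3 : a • q + b • AffineMap.lineMap q (y : E) b⁻¹ = (y : E) := by
      rw [AffineMap.lineMap_apply_module, smul_add, smul_smul, smul_smul, mul_sub,
        mul_inv_cancel₀ hb.ne', ← add_assoc, ← add_smul]
      have : a + (b * 1 - 1) = 0 := by linarith
      rw [this]; simp
    rwa [h3] at h2
  · have : g ⟨_, hmem p b p.2⟩ = p := by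
      apply Subtype.ext
      simp only [g, AffineMap.lineMap_apply_module]
      rw [smul_add, smul_smul, smul_smul, inv_mul_cancel₀ hb.ne', one_smul, ← add_assoc,
        ← add_smul]
      have : 1 - b⁻¹ + b⁻¹ * (1 - b) = 0 := by field_simp; ring
      rw [this]; simp
    rwa [Set.mem_preimage, this]

theorem mem_intrinsicInterior_coneFace [FiniteDimensional ℝ E] {K : PointedCone ℝ E} {v : E}
    (hv : v ∈ K) : v ∈ intrinsicInterior ℝ (coneFace K v) := by
  obtain ⟨p, hp⟩ := Set.Nonempty.intrinsicInterior (convex_coneFace K v)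
    ⟨v, self_mem_coneFace hv⟩
  obtain ⟨hpK, t, ht, h⟩ := intrinsicInterior_subset hp
  have ht1 : (0 : ℝ) < 1 + t := by linarith
  have ht2 : (0 : ℝ) < 2 + t := by linarith
  -- Since `(2 + t) • v` is the sum of `p` and `(2 + t) • v - p`, scaling the latter by `(1 + t)⁻¹`
  -- makes `v` a convex combination.
  refine mem_intrinsicInterior_of_mem_openSegment (convex_coneFace K v) hp
    (q := (1 + t)⁻¹ • ((2 + t) • v - p)) ?_ ?_
  · apply smul_mem_coneFace (inv_pos.2 ht1).le
    have h1 : (2 + t) • v - p ∈ K := by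
      convert K.add_mem h (PointedCone.smul_mem K (zero_le_two (α := ℝ)) hv) using 1
      module
    refine ⟨h1, 2 + t, ht2.le, ?_⟩
    simpa using hpK
  · refine ⟨(1 + t) / (2 + t), 1 / (2 + t), by positivity, by positivity, ?_, ?_⟩
    · field_simp
      ring
    · rw [smul_smul, smul_sub, smul_smul]
      have h1 : (1 + t) / (2 + t) * (1 + t)⁻¹ = 1 / (2 + t) := by field_simp
      have h2 : 1 / (2 + t) * (2 + t) = 1 := by field_simp
      rw [h1, h2]
      module

/-- The dimension of the linear hull of the face of `K` generated by `v`. -/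
noncomputable def coneFaceDim (K : PointedCone ℝ E) (v : E) : ℕ :=
  Module.finrank ℝ (Submodule.span ℝ (coneFace K v))

/-- `w` is an order unit of the span of its face. Both signs are carried along because a negative
scalar swaps them. -/
theorem exists_bound_of_mem_span_coneFace {K : PointedCone ℝ E} {w p : E} (hw : w ∈ K)
    (hp : p ∈ Submodule.span ℝ (coneFace K w)) :
    ∃ s : ℝ, 0 ≤ s ∧ s • w - p ∈ K ∧ s • w + p ∈ K := by
  induction hp using Submodule.span_induction with
  | mem x hx =>
    obtain ⟨hx, t, ht, h⟩ := hx
    exact ⟨t, ht, h, K.add_mem (PointedCone.smul_mem K ht hw) hx⟩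
  | zero => exact ⟨0, le_rfl, by simp, by simp⟩
  | add x y _ _ hx hy =>
    obtain ⟨s, hs, h1, h2⟩ := hx
    obtain ⟨t, ht, h3, h4⟩ := hy
    refine ⟨s + t, add_nonneg hs ht, ?_, ?_⟩
    · convert K.add_mem h1 h3 using 1
      module
    · convert K.add_mem h2 h4 using 1
      module
  | smul c x _ hx =>
    obtain ⟨s, hs, h1, h2⟩ := hx
    rcases le_total 0 c with hc | hc
    · refine ⟨c * s, mul_nonneg hc hs, ?_, ?_⟩
      · convert PointedCone.smul_mem K hc h1 using 1
        module
      · convert PointedCone.smul_mem K hc h2 using 1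
        module
    · refine ⟨-c * s, mul_nonneg (neg_nonneg.2 hc) hs, ?_, ?_⟩
      · convert PointedCone.smul_mem K (neg_nonneg.2 hc) h2 using 1
        module
      · convert PointedCone.smul_mem K (neg_nonneg.2 hc) h1 using 1
        module

/-- If the spans agreed, the order unit `w` would dominate `v`. -/
theorem coneFaceDim_lt [FiniteDimensional ℝ E] {K : PointedCone ℝ E} {v w : E} (hv : v ∈ K)
    (hw : w ∈ coneFace K v) (hvw : v ∉ coneFace K w) : coneFaceDim K w < coneFaceDim K v := by
  apply Submodule.finrank_lt_finrank_of_lt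
  refine lt_of_le_of_ne (Submodule.span_mono (coneFace_subset hw)) fun h => hvw ?_
  have hv' : v ∈ Submodule.span ℝ (coneFace K w) :=
    h ▸ Submodule.subset_span (self_mem_coneFace hv)
  obtain ⟨s, hs, h1, -⟩ := exists_bound_of_mem_span_coneFace hw.1 hv'
  exact ⟨hv, s, hs, h1⟩

/-- Subtracting a maximal multiple of `u` from `v` leads to a smaller face. -/
theorem exists_sub_smul_mem_coneFace {K : PointedCone ℝ E} (hK : IsClosed (K : Set E))
    {u v : E} (hv : v ∈ K) (huv : u ∈ coneFace K v) (hu : -u ∉ K) :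
    ∃ t : ℝ, 0 ≤ t ∧ v - t • u ∈ coneFace K v ∧ v ∉ coneFace K (v - t • u) := by
  obtain ⟨huK, τ, hτ, hτu⟩ := huv
  let A : Set ℝ := {t | 0 ≤ t ∧ v - t • u ∈ K}
  have hA : IsClosed A := by
    refine isClosed_Ici.inter (hK.preimage (f := fun t : ℝ => v - t • u) ?_)
    fun_prop
  have hne : A.Nonempty := ⟨0, le_rfl, by simpa using hv⟩
  -- Otherwise `t⁻¹ • v - u` stays in the closed cone for a sequence `t → ∞`, and its limit is `-u`.
  have hbdd : BddAbove A := by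
    by_contra hb
    apply hu
    have hex : ∀ n : ℕ, ∃ t ∈ A, (n : ℝ) + 1 < t := fun n => by
      by_contra! h
      exact hb ⟨n + 1, h⟩
    choose t htA ht using hex
    have hpos : ∀ n, 0 < t n := fun n => lt_trans (by positivity) (ht n)
    have hlim : Filter.Tendsto t Filter.atTop Filter.atTop :=
      Filter.tendsto_atTop_mono (fun n => by have := ht n; linarith) tendsto_natCast_atTop_atTop
    have hlim2 : Filter.Tendsto (fun n => (t n)⁻¹ • v - u) Filter.atTop (nhds (-u)) := by
      have := ((tendsto_inv_atTop_zero.comp hlim).smul_const v).sub_const u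
      simpa using this
    refine hK.mem_of_tendsto hlim2 (Filter.Eventually.of_forall fun n => ?_)
    have := PointedCone.smul_mem K (inv_pos.2 (hpos n)).le (htA n).2
    rwa [smul_sub, inv_smul_smul₀ (hpos n).ne'] at this
  obtain ⟨h0, hmem⟩ := hA.csSup_mem hne hbdd
  refine ⟨sSup A, h0, ⟨hmem, 1, zero_le_one, ?_⟩, ?_⟩
  · simpa using PointedCone.smul_mem K h0 huK
  -- If the remainder dominated `v`, it would also dominate `u`, so a larger multiple of `u` could
  -- be subtracted.
  · rintro ⟨-, s, hs, h⟩
    have h1 : (τ * s) • (v - sSup A • u) - u ∈ K := by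
      convert K.add_mem (PointedCone.smul_mem K hτ h) hτu using 1
      module
    rcases (mul_nonneg hτ hs).eq_or_lt with h2 | h2
    · rw [← h2] at h1
      exact hu (by simpa using h1)
    · have h3 : sSup A + (τ * s)⁻¹ ∈ A := by
        refine ⟨add_nonneg h0 (inv_pos.2 h2).le, ?_⟩
        have h4 := PointedCone.smul_mem K (inv_pos.2 h2).le h1
        rw [smul_sub, inv_smul_smul₀ h2.ne'] at h4
        convert h4 using 1
        module
      have h5 := le_csSup hbdd h3
      have := inv_pos.2 h2
      linarith

theorem mem_coneFace_of_mem_intrinsicInterior {K : PointedCone ℝ E} {u v : E}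
    (hv : v ∈ intrinsicInterior ℝ (K : Set E)) (hu : u ∈ K) : u ∈ coneFace K v := by
  obtain ⟨t, ht, h⟩ := exists_prolong_of_mem_intrinsicInterior hv hu
  refine ⟨hu, t⁻¹ * (1 + t), by positivity, ?_⟩
  have h1 := PointedCone.smul_mem K (inv_pos.2 ht).le (x := v + t • (v - u)) h
  rw [smul_add, inv_smul_smul₀ ht.ne'] at h1
  have h2 : t⁻¹ * (1 + t) = t⁻¹ + 1 := by field_simp
  rw [h2]
  convert h1 using 1
  module

theorem vectorSpan_eq_span_of_zero_mem {S : Set E} (h : (0 : E) ∈ S) :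
    vectorSpan ℝ S = Submodule.span ℝ S := by
  rw [vectorSpan_eq_span_vsub_set_right ℝ h]
  simp

end ConeFaces

/-! ### Normal cones, their faces and atoms. -/

section NormalCones

variable {E : Type*} [NormedAddCommGroup E] [InnerProductSpace ℝ E]

/-- The normal cone of `C` at `x` as a pointed cone. -/
def normalPointedCone (C : Set E) (x : E) : PointedCone ℝ E where
  carrier := normalConeAt C x
  add_mem' {a b} ha hb y hy := by
    rw [inner_add_left]
    exact add_nonpos (ha y hy) (hb y hy)
  zero_mem' y _ := by simp
  smul_mem' c a ha y hy := by
    change inner ℝ ((c : ℝ) • a) (y - x) ≤ 0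
    rw [real_inner_smul_left]
    exact mul_nonpos_of_nonneg_of_nonpos c.2 (ha y hy)

theorem mem_normalPointedCone {C : Set E} {x u : E} :
    u ∈ normalPointedCone C x ↔ ∀ y ∈ C, inner ℝ u (y - x) ≤ 0 := Iff.rfl

theorem isClosed_normalPointedCone (C : Set E) (x : E) :
    IsClosed (normalPointedCone C x : Set E) := by
  have : (normalPointedCone C x : Set E) = ⋂ y ∈ C, {u | inner ℝ u (y - x) ≤ 0} := by
    ext u
    simp [mem_normalPointedCone]
  rw [this]
  exact isClosed_biInter fun y _ => isClosed_le (by fun_prop) continuous_const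

theorem inner_eq_zero_of_mem_linOrthogonal {C : Set E} {u x y : E} (hu : u ∈ linOrthogonal C)
    (hx : x ∈ C) (hy : y ∈ C) : inner ℝ u (y - x) = 0 :=
  (Submodule.mem_orthogonal' _ _).1 hu _ (vsub_mem_vectorSpan ℝ hy hx)

theorem mem_linOrthogonal_iff {C : Set E} {x u : E} (hx : x ∈ C) :
    u ∈ linOrthogonal C ↔ u ∈ normalPointedCone C x ∧ -u ∈ normalPointedCone C x := by
  simp only [mem_normalPointedCone, inner_neg_left]
  refine ⟨fun h => ⟨fun y hy => ?_, fun y hy => ?_⟩, fun ⟨h1, h2⟩ => ?_⟩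
  · rw [inner_eq_zero_of_mem_linOrthogonal h hx hy]
  · rw [inner_eq_zero_of_mem_linOrthogonal h hx hy, neg_zero]
  · rw [linOrthogonal, vectorSpan_eq_span_vsub_set_right ℝ hx, Submodule.mem_orthogonal']
    intro p hp
    induction hp using Submodule.span_induction with
    | mem p hp =>
      obtain ⟨y, hy, rfl⟩ := hp
      have h3 := h1 y hy
      have h4 := h2 y hy
      change inner ℝ u (y - x) = 0
      linarith
    | zero => simp
    | add p q _ _ hp hq => rw [inner_add_right, hp, hq, add_zero]
    | smul c p _ hp => rw [inner_smul_right, hp, mul_zero]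

/-- As `w` is normal at both points, it takes the same value at `x` and `z`. Since `u` and `t • w -
u` are both normal at `x`, `u` also takes equal values there. -/
theorem coneFace_normalPointedCone_subset {C : Set E} {x z w : E} (hx : x ∈ C) (hz : z ∈ C)
    (hwx : w ∈ normalPointedCone C x) (hwz : w ∈ normalPointedCone C z) :
    coneFace (normalPointedCone C x) w ⊆ normalPointedCone C z := by
  rintro u ⟨hu, t, -, h⟩ y hy
  have h1 := hwx z hz
  have h2 := hwz x hx
  have h3 := hu z hz
  have h4 := h z hz
  have h5 := hu y hy
  simp only [inner_sub_left, inner_sub_right, real_inner_smul_left] at *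
  have h6 : t * inner ℝ w z - t * inner ℝ w x = 0 := by
    rw [← mul_sub, le_antisymm h1 (by linarith), mul_zero]
  linarith

theorem convex_exposedFaceBy {C : Set E} (hC : Convex ℝ C) (v : E) :
    Convex ℝ (exposedFaceBy C v) := by
  intro p hp q hq a b ha hb hab
  refine ⟨hC hp.1 hq.1 ha hb hab, fun y hy => ?_⟩
  rw [inner_add_right, inner_smul_right, inner_smul_right]
  have h1 := mul_le_mul_of_nonneg_left (hp.2 y hy) ha
  have h2 := mul_le_mul_of_nonneg_left (hq.2 y hy) hb
  have h3 : a * inner ℝ v y + b * inner ℝ v y = inner ℝ v y := by rw [← add_mul, hab, one_mul]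
  linarith

variable [FiniteDimensional ℝ E]

theorem eq_univ_or_eq_normalPointedCone {C M : Set E} (hM : M ∈ normalConeLattice C) :
    M = Set.univ ∨ ∃ x ∈ C, M = normalPointedCone C x := by
  obtain ⟨F, hF, rfl⟩ := hM
  rcases F.eq_empty_or_nonempty with rfl | hne
  · exact Or.inl (normalConeOf_empty C)
  · obtain ⟨x, hx⟩ := Set.Nonempty.intrinsicInterior hF.2.1 hne
    exact Or.inr ⟨x, hF.1 (intrinsicInterior_subset hx), normalConeOf_eq_normalConeAt hF.1 hx⟩

theorem linOrthogonal_subset_of_mem {C M : Set E} (hM : M ∈ normalConeLattice C) :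
    (linOrthogonal C : Set E) ⊆ M := by
  rcases eq_univ_or_eq_normalPointedCone hM with rfl | ⟨x, hx, rfl⟩
  · exact Set.subset_univ _
  · exact fun u hu => ((mem_linOrthogonal_iff hx).1 hu).1

theorem add_mem_of_mem_normalConeLattice {C M : Set E} (hM : M ∈ normalConeLattice C) {u v : E}
    (hu : u ∈ M) (hv : v ∈ M) : u + v ∈ M := by
  rcases eq_univ_or_eq_normalPointedCone hM with rfl | ⟨x, hx, rfl⟩
  · trivial
  · exact (normalPointedCone C x).add_mem hu hv

/-- Faces of a normal cone, except its lineality space, are touching cones. -/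
theorem coneFace_mem_touchingConeLattice {C : Set E} (hC : Convex ℝ C) {x v : E} (hx : x ∈ C)
    (hv : v ∈ normalPointedCone C x) (hv0 : v ≠ 0) :
    coneFace (normalPointedCone C x) v ∈ touchingConeLattice C := by
  have hxF : x ∈ exposedFaceBy C v := by
    refine ⟨hx, fun y hy => ?_⟩
    have := hv y hy
    rw [inner_sub_right] at this
    linarith
  refine Or.inl ⟨v, hv0, ⟨x, hxF⟩, ?_, mem_intrinsicInterior_coneFace hv⟩
  obtain ⟨z, hz⟩ := Set.Nonempty.intrinsicInterior (convex_exposedFaceBy hC v) ⟨x, hxF⟩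
  have hFC : exposedFaceBy C v ⊆ C := fun y hy => hy.1
  have hzF := intrinsicInterior_subset hz
  rw [normalConeOf_eq_normalConeAt hFC hz]
  change IsConvexFace (normalPointedCone C z : Set E) _
  have hvz : v ∈ normalPointedCone C z := fun y hy => by
    have := hzF.2 y hy
    rw [inner_sub_right]
    linarith
  obtain ⟨-, hcv, hface⟩ := isConvexFace_coneFace (normalPointedCone C x) v
  -- Prolonging the segment from `x` beyond `z` inside the exposed face gives `⟪u, z - x⟫ ≤ 0`. The
  -- face property then restricts to the smaller cone at `z`.
  have hle : ∀ u ∈ normalPointedCone C z, u ∈ normalPointedCone C x := by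
    intro u hu y hy
    obtain ⟨t, ht, hmem⟩ := exists_prolong_of_mem_intrinsicInterior hz hxF
    have h1 := hu _ hmem.1
    have h2 := hu y hy
    rw [add_sub_cancel_left, inner_smul_right] at h1
    have h3 := nonpos_of_mul_nonpos_right h1 ht
    simp only [inner_sub_right] at *
    linarith
  exact ⟨coneFace_normalPointedCone_subset hx hzF.1 hv hvz, hcv,
    fun a ha b hb h => hface a (hle a ha) b (hle b hb) h⟩

/-- Every point of the normal cone off its lineality space dominates a generator of an atom. -/
theorem exists_coneFace_isPosetAtom {C : Set E} (hC : Convex ℝ C) {x v : E} (hx : x ∈ C)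
    (hN : (normalPointedCone C x : Set E) ≠ Set.univ)
    (hT : ∀ T ∈ touchingConeLattice C, T ⊆ (normalPointedCone C x : Set E) →
      T ∈ normalConeLattice C)
    (hv : v ∈ normalPointedCone C x) (hvL : v ∉ linOrthogonal C) :
    ∃ u ∈ coneFace (normalPointedCone C x) v, u ∉ linOrthogonal C ∧
      ∃ A : normalConeLattice C, IsPosetAtom A ∧
        (A : Set E) = coneFace (normalPointedCone C x) u := by
  set K := normalPointedCone C x with hK
  have hex : ∃ n, ∃ u ∈ coneFace K v, u ∉ linOrthogonal C ∧ coneFaceDim K u = n :=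
    ⟨_, v, self_mem_coneFace hv, hvL, rfl⟩
  classical
  -- `u` generates a face of least dimension among the points of the face of `v` off the lineality
  -- space.
  obtain ⟨u, huv, huL, hun⟩ := Nat.find_spec hex
  have hu0 : u ≠ 0 := fun h => huL (h ▸ Submodule.zero_mem _)
  have huK : u ∈ K := huv.1
  have hmin : ∀ w ∈ coneFace K u, w ∉ linOrthogonal C → u ∈ coneFace K w := by
    intro w hw hwL
    by_contra h
    have h1 := coneFaceDim_lt huK hw h
    rw [hun] at h1
    exact Nat.find_min hex h1 ⟨w, coneFace_trans hw huv, hwL, rfl⟩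
  have hmem : coneFace K u ∈ normalConeLattice C :=
    hT _ (coneFace_mem_touchingConeLattice hC hx huK hu0) fun _ h => h.1
  have hLmem : (linOrthogonal C : Set E) ∈ normalConeLattice C :=
    hT _ (Or.inr (Or.inl rfl)) fun w hw => ((mem_linOrthogonal_iff hx).1 hw).1
  refine ⟨u, huv, huL, ⟨_, hmem⟩, ⟨⟨_, hLmem⟩, fun M => linOrthogonal_subset_of_mem M.2, ?_, ?_⟩,
    rfl⟩
  · intro h
    have h1 : coneFace K u = (linOrthogonal C : Set E) := congrArg Subtype.val h
    exact huL (h1 ▸ self_mem_coneFace huK : u ∈ (linOrthogonal C : Set E))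
  · rintro ⟨M, hM⟩ hle hne
    have hle : M ⊆ coneFace K u := hle
    have hne : M ≠ coneFace K u := fun h => hne (Subtype.ext h)
    refine Subtype.ext (Set.Subset.antisymm ?_ (linOrthogonal_subset_of_mem hM))
    change M ⊆ (linOrthogonal C : Set E)
    rcases eq_univ_or_eq_normalPointedCone hM with rfl | ⟨z, hz, rfl⟩
    · exact absurd (Set.eq_univ_of_univ_subset fun w hw => (hle hw).1) hN
    · obtain ⟨w, hw⟩ := Set.Nonempty.intrinsicInterior
        (s := (normalPointedCone C z : Set E)) (fun p hp q hq a b ha hb _ =>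
          (normalPointedCone C z).add_mem (PointedCone.smul_mem _ ha hp)
            (PointedCone.smul_mem _ hb hq)) ⟨0, (normalPointedCone C z).zero_mem⟩
      have hwz := intrinsicInterior_subset hw
      -- The relative interior point `w` decides: in the lineality space it forces all of `M` there;
      -- otherwise minimality puts `u` in the face of `w`, which lies in `M`.
      by_cases hwL : w ∈ linOrthogonal C
      · intro p hp
        obtain ⟨-, t, ht, h⟩ := mem_coneFace_of_mem_intrinsicInterior hw hp
        refine (mem_linOrthogonal_iff hz).2 ⟨hp, ?_⟩
        have h1 := ((mem_linOrthogonal_iff hz).1 hwL).2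
        convert (normalPointedCone C z).add_mem h (PointedCone.smul_mem _ ht h1) using 1
        module
      · refine absurd (Set.Subset.antisymm hle ?_) hne
        exact (coneFace_subset (hmin w (hle hwz) hwL)).trans
          (coneFace_normalPointedCone_subset hx hz (hle hwz).1 hwz)

theorem finrank_linOrthogonal_le_coneFaceDim {C : Set E} {x : E} (hx : x ∈ C) (v : E) :
    Module.finrank ℝ (linOrthogonal C) ≤ coneFaceDim (normalPointedCone C x) v := by
  refine Submodule.finrank_mono fun u hu => Submodule.subset_span ?_
  obtain ⟨h1, h2⟩ := (mem_linOrthogonal_iff hx).1 hu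
  refine ⟨h1, 0, le_rfl, by simpa using h2⟩

/-- Every point of `N` lies in all normal cones above suitable atoms, whose number is controlled by
the dimension of the face generated by the point. -/
theorem exists_finset_isPosetAtom {C : Set E} (hC : Convex ℝ C) {x : E} (hx : x ∈ C)
    (hN : (normalPointedCone C x : Set E) ≠ Set.univ)
    (hT : ∀ T ∈ touchingConeLattice C, T ⊆ (normalPointedCone C x : Set E) →
      T ∈ normalConeLattice C) (n : ℕ) :
    ∀ v ∈ normalPointedCone C x, coneFaceDim (normalPointedCone C x) v = n →
    ∃ S : Finset (normalConeLattice C),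
      (∀ A ∈ S, IsPosetAtom A ∧ (A : Set E) ⊆ normalPointedCone C x) ∧
      (∀ M ∈ normalConeLattice C, (∀ A ∈ S, (A : Set E) ⊆ M) → v ∈ M) ∧
      S.card + Module.finrank ℝ (linOrthogonal C) ≤ n := by
  classical
  induction n using Nat.strong_induction_on with
  | _ n ih =>
    rintro v hv rfl
    by_cases hvL : v ∈ linOrthogonal C
    · refine ⟨∅, by simp, fun M hM _ => linOrthogonal_subset_of_mem hM hvL, ?_⟩
      simpa using finrank_linOrthogonal_le_coneFaceDim hx v
    · obtain ⟨u, huv, huL, A, hA, hAu⟩ := exists_coneFace_isPosetAtom hC hx hN hT hv hvL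
      have hu : -u ∉ normalPointedCone C x := fun h =>
        huL ((mem_linOrthogonal_iff hx).2 ⟨huv.1, h⟩)
      obtain ⟨t, ht, h1, h2⟩ :=
        exists_sub_smul_mem_coneFace (isClosed_normalPointedCone C x) hv huv hu
      -- The drop in dimension pays for the one new atom.
      have hlt := coneFaceDim_lt hv h1 h2
      obtain ⟨S, hS1, hS2, hS3⟩ := ih _ hlt _ h1.1 rfl
      refine ⟨insert A S, ?_, ?_, ?_⟩
      · intro B hB
        rcases Finset.mem_insert.1 hB with rfl | hB
        · exact ⟨hA, hAu ▸ fun w hw => hw.1⟩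
        · exact hS1 B hB
      · intro M hM hAM
        have h3 := hS2 M hM fun B hB => hAM B (Finset.mem_insert_of_mem hB)
        have h4 : t • u ∈ M := by
          apply hAM A (Finset.mem_insert_self A S)
          rw [hAu]
          exact smul_mem_coneFace ht (self_mem_coneFace huv.1)
        simpa using add_mem_of_mem_normalConeLattice hM h3 h4
      · have := Finset.card_insert_le A S
        omega

end NormalCones

theorem mainTheorem2 {E : Type*} [NormedAddCommGroup E] [InnerProductSpace ℝ E]
    [FiniteDimensional ℝ E] (C : Set E) (hC : Convex ℝ C)
    (N : normalConeLattice C) (hN : IsProperNormalCone C (N : Set E))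
    (hT : ∀ T ∈ touchingConeLattice C, T ⊆ (N : Set E) → T ∈ normalConeLattice C) :
    ∃ S : Finset (normalConeLattice C),
      (∀ A ∈ S, IsPosetAtom A) ∧
      IsLUB (S : Set (normalConeLattice C)) N ∧
      S.card + convexDim (linOrthogonal C : Set E) ≤ convexDim (N : Set E) := by
  obtain ⟨N, hNC⟩ := N
  obtain ⟨-, -, hNu⟩ := hN
  change N ≠ Set.univ at hNu
  obtain ⟨x, hx, rfl⟩ := (eq_univ_or_eq_normalPointedCone hNC).resolve_left hNu
  obtain ⟨v, hv⟩ := Set.Nonempty.intrinsicInterior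
    (s := (normalPointedCone C x : Set E)) (fun p hp q hq a b ha hb _ =>
      (normalPointedCone C x).add_mem (PointedCone.smul_mem _ ha hp)
        (PointedCone.smul_mem _ hb hq)) ⟨0, (normalPointedCone C x).zero_mem⟩
  have hvN : v ∈ normalPointedCone C x := intrinsicInterior_subset hv
  obtain ⟨S, hS1, hS2, hS3⟩ := exists_finset_isPosetAtom hC hx hNu hT _ v hvN rfl
  refine ⟨S, fun A hA => (hS1 A hA).1, ⟨fun A hA => (hS1 A hA).2, ?_⟩, ?_⟩
  · rintro ⟨M, hM⟩ hub
    -- The face generated by the relative interior point `v` is all of `N`, so `v ∈ M` suffices.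
    have hvM : v ∈ M := hS2 M hM fun A hA => hub hA
    change (normalPointedCone C x : Set E) ⊆ M
    rcases eq_univ_or_eq_normalPointedCone hM with rfl | ⟨y, hy, rfl⟩
    · exact Set.subset_univ _
    · exact fun u hu => coneFace_normalPointedCone_subset hx hy hvN hvM
        (mem_coneFace_of_mem_intrinsicInterior hv hu)
  · have h1 : convexDim (linOrthogonal C : Set E) = Module.finrank ℝ (linOrthogonal C) := by
      rw [convexDim, vectorSpan_eq_span_of_zero_mem (Submodule.zero_mem _), Submodule.span_eq]
    rw [h1, convexDim, vectorSpan_eq_span_of_zero_mem (normalPointedCone C x).zero_mem]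
    exact hS3.trans (Submodule.finrank_mono (Submodule.span_mono fun u hu => hu.1))
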